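/- Let $\mathcal C$ be an algebraically closed field of characteristic $0$, let $n_1,n_2\ge 0$ and $n=n_1+n_2$; matrices in $\mathcal M_n(\mathcal C)$ are written in blocks with diagonal blocks of sizes $n_1\times n_1$ and $n_2\times n_2$. A linear algebraic group is a Zariski closed subgroup $G$ of $\mathrm{GL}_n(\mathcal C)$, and its Lie algebra is the set of all $N\in\mathcal M_n(\mathcal C)$ such that $\mathrm{Id}_n+\varepsilon N$ satisfies modulo $\varepsilon^2$ all polynomial equations that hold on $G$. A Lie subalgebra of $\mathcal M_n(\mathcal C)$ is called algebraic if it is the Lie algebra of a linear algebraic group. Let $H_{\mathrm{diag}}\subset \mathrm{GL}_n(\mathcal C)$ be a (Zariski) connected linear algebraic group of block-diagonal matrices $\begin{pmatrix} H_1&0\\0&H_2\end{pmatrix}$, and let $\mathfrak h_{\mathrm{diag}}$ be its Lie algebra. Let $\mathfrak h_{\mathrm{sub}}$ be a $\mathcal C$-vector space of matrices of the form $\begin{pmatrix}0&0\\X&0\end{pmatrix}$ such that $$\begin{pmatrix}0&0\\N_2X-XN_1&0\end{pmatrix}\in\mathfrak h_{\mathrm{sub}}\quad\text{for all } \begin{pmatrix}N_1&0\\0&N_2\end{pmatrix}\in\mathfrak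 h_{\mathrm{diag}},\ \begin{pmatrix}0&0\\X&0\end{pmatrix}\in\mathfrak h_{\mathrm{sub}}.$$ Let $H_{\mathrm{sub}}=\{\mathrm{Id}_n+B : B\in\mathfrak h_{\mathrm{sub}}\}$, and let $H$ be the subgroup of $\mathrm{GL}_n(\mathcal C)$ generated by $H_{\mathrm{diag}}$ and $H_{\mathrm{sub}}$. Then $H$ is Zariski closed and connected, i.e. a connected linear algebraic group; the sum $\mathfrak h=\mathfrak h_{\mathrm{diag}}+\mathfrak h_{\mathrm{sub}}$ is direct; and the Lie algebra of $H$ is $\mathfrak h=\mathfrak h_{\mathrm{diag}}\oplus\mathfrak h_{\mathrm{sub}}$. In particular $\mathfrak h$ is an algebraic Lie algebra. -/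

import Mathlib

/- Matrices carry the commutator bracket. -/
attribute [local instance 100] LieRing.ofAssociativeRing

/-- The matrix `M`, read as the point of affine space whose coordinates are its entries. -/
def Matrix.entries {ι R : Type*} (M : Matrix ι ι R) : ι × ι → R := fun p => M p.1 p.2

namespace LinAlgGroup

open MvPolynomial

section Basic

variable {ι K : Type*} [Fintype ι] [DecidableEq ι] [Field K]

/-- The Zariski topology on `GL ι K`: the closed sets are the sets of common zeros, in `GL ι K`,
of polynomials in the matrix entries. (Allowing `1 / det` in the equations gives the same sets.) -/
@[reducible]
def zariski (ι K : Type*) [Fintype ι] [DecidableEq ι] [Field K] :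
    TopologicalSpace (GL ι K) :=
  TopologicalSpace.ofClosed
    {Z | ∃ I : Ideal (MvPolynomial (ι × ι) K),
      Z = {g : GL ι K | g.val.entries ∈ zeroLocus K I}}
    ⟨⊤, by
      ext g
      simp only [Set.mem_empty_iff_false, Set.mem_ofPred_eq, false_iff, mem_zeroLocus_iff]
      intro h
      simpa using h 1 trivial⟩
    (by
      intro A hA
      have hA' : ∀ Z ∈ A, ∃ I : Ideal (MvPolynomial (ι × ι) K),
          Z = {g : GL ι K | g.val.entries ∈ zeroLocus K I} := fun Z hZ => hA hZ
      choose! J hJ using hA'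
      refine ⟨sSup (J '' A), ?_⟩
      ext g
      simp only [Set.mem_sInter, Set.mem_ofPred_eq, mem_zeroLocus_iff]
      constructor
      · intro h
        have : sSup (J '' A) ≤ RingHom.ker (aeval (R := K) g.val.entries) := by
          refine sSup_le ?_
          rintro _ ⟨Z, hZ, rfl⟩ p hp
          have := h Z hZ
          rw [hJ Z hZ] at this
          exact this p hp
        exact fun p hp => this hp
      · intro h Z hZ
        rw [hJ Z hZ]
        exact fun p hp => h p (le_sSup (Set.mem_image_of_mem J hZ) hp))
    (by
      rintro _ ⟨I, rfl⟩ _ ⟨J, rfl⟩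
      refine ⟨I * J, ?_⟩
      ext g
      simp only [Set.mem_union, Set.mem_ofPred_eq, mem_zeroLocus_iff]
      constructor
      · rintro (h | h) p hp
        · exact h p ((Ideal.mul_le_left : I * J ≤ I) hp)
        · exact h p ((Ideal.mul_le_right : I * J ≤ J) hp)
      · intro h
        by_contra! hc
        obtain ⟨⟨p, hp, hp0⟩, q, hq, hq0⟩ := hc
        have := h _ (Ideal.mul_mem_mul hp hq)
        rw [map_mul] at this
        exact (mul_ne_zero hp0 hq0) this)

/-- A linear algebraic group: a Zariski closed subgroup of `GL ι K`. -/
def IsAlgebraicGroup (G : Subgroup (GL ι K)) : Prop :=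
  @IsClosed (GL ι K) (zariski ι K) (G : Set (GL ι K))

/-- Connectedness in the Zariski topology. -/
def IsZariskiConnected (G : Subgroup (GL ι K)) : Prop :=
  @IsConnected (GL ι K) (zariski ι K) (G : Set (GL ι K))

/-- The ideal of all polynomials in the matrix entries that vanish on `G`. -/
def ideal (G : Subgroup (GL ι K)) : Ideal (MvPolynomial (ι × ι) K) :=
  vanishingIdeal K ((fun g : GL ι K => g.val.entries) '' (G : Set (GL ι K)))

/-- The matrix `Id + ε N` over the dual numbers `K[ε]`, `ε² = 0`. -/
def onePlusEps (N : Matrix ι ι K) : Matrix ι ι (DualNumber K) :=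
  1 + (DualNumber.eps : DualNumber K) • N.map (algebraMap K (DualNumber K))

/-- `N` is tangent to `G` at the identity: `Id + ε N` satisfies the equations of `G`
modulo `ε²`. -/
def IsTangent (G : Subgroup (GL ι K)) (N : Matrix ι ι K) : Prop :=
  ∀ p ∈ ideal G, aeval (onePlusEps N).entries p = 0

theorem mem_ideal {G : Subgroup (GL ι K)} {p : MvPolynomial (ι × ι) K} :
    p ∈ ideal G ↔ ∀ g ∈ G, aeval g.val.entries p = 0 := by
  simp [ideal, mem_vanishingIdeal_iff]

theorem aeval_onePlusEps (N : Matrix ι ι K) (p : MvPolynomial (ι × ι) K) :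
    aeval (onePlusEps N).entries p =
      TrivSqZeroExt.inl (aeval (1 : Matrix ι ι K).entries p) +
      TrivSqZeroExt.inr (∑ x, N.entries x * aeval (1 : Matrix ι ι K).entries (pderiv x p)) := by
  induction p using MvPolynomial.induction_on with
  | C a => simp [TrivSqZeroExt.algebraMap_eq_inl]
  | add p q hp hq =>
    rw [map_add, hp, hq]
    simp only [map_add, mul_add, Finset.sum_add_distrib, TrivSqZeroExt.inl_add,
      TrivSqZeroExt.inr_add]
    ring
  | mul_X p x hp =>
    rw [map_mul, hp, aeval_X]
    have hx : (onePlusEps N).entries x =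
        TrivSqZeroExt.inl ((1 : Matrix ι ι K).entries x) + TrivSqZeroExt.inr (N.entries x) := by
      obtain ⟨i, j⟩ := x
      ext <;> by_cases h : i = j <;>
        simp [onePlusEps, Matrix.entries, Matrix.one_apply, h, TrivSqZeroExt.algebraMap_eq_inl]
    rw [hx]
    have hs : ∀ y, N.entries y * aeval (1 : Matrix ι ι K).entries (pderiv y (p * X x)) =
        (N.entries y * aeval (1 : Matrix ι ι K).entries (pderiv y p)) *
          (1 : Matrix ι ι K).entries x +
        (if y = x then aeval (1 : Matrix ι ι K).entries p * N.entries x else 0) := by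
      intro y
      rw [Derivation.leibniz, pderiv_X]
      by_cases h : y = x
      · subst h
        simp
        ring
      · simp [h, Ne.symm h]
        ring
    rw [Finset.sum_congr rfl (fun y _ => hs y), Finset.sum_add_distrib, ← Finset.sum_mul,
      Finset.sum_ite_eq' Finset.univ x]
    ext
    · simp
    · simp
      ring

theorem isTangent_iff {G : Subgroup (GL ι K)} {N : Matrix ι ι K} :
    IsTangent G N ↔ ∀ p ∈ ideal G,
      ∑ x, N.entries x * aeval (1 : Matrix ι ι K).entries (pderiv x p) = 0 := by
  refine forall₂_congr fun p hp => ?_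
  have h1 := mem_ideal.1 hp 1 G.one_mem
  rw [Units.val_one] at h1
  rw [aeval_onePlusEps, h1]
  simp [TrivSqZeroExt.ext_iff]

theorem onePlusEps_conj (g : GL ι K) (M : Matrix ι ι K) :
    onePlusEps (g.val * M * g⁻¹.val) =
      g.val.map (algebraMap K (DualNumber K)) * onePlusEps M *
        g⁻¹.val.map (algebraMap K (DualNumber K)) := by
  have h : g.val.map (algebraMap K (DualNumber K)) *
      g⁻¹.val.map (algebraMap K (DualNumber K)) = 1 := by
    rw [← Matrix.map_mul, ← Units.val_mul, mul_inv_cancel]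
    simp
  simp only [onePlusEps, mul_add, add_mul, mul_one, h, Matrix.map_mul, Matrix.mul_smul,
    Matrix.smul_mul]

theorem aeval_conj {A : Type*} [CommRing A] [Algebra K A] (P Q : Matrix ι ι K)
    (T : Matrix ι ι A) (p : MvPolynomial (ι × ι) K) :
    aeval T.entries (aeval (P.map C * Matrix.mvPolynomialX ι ι K * Q.map C).entries p) =
      aeval (P.map (algebraMap K A) * T * Q.map (algebraMap K A)).entries p := by
  rw [← AlgHom.comp_apply]
  congr 1
  apply MvPolynomial.algHom_ext
  intro x
  simp [Matrix.entries, Matrix.mul_apply, Matrix.mvPolynomialX_apply]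

theorem IsTangent.conj {G : Subgroup (GL ι K)} {M : Matrix ι ι K} (hM : IsTangent G M)
    {g : GL ι K} (hg : g ∈ G) : IsTangent G (g.val * M * g⁻¹.val) := by
  intro p hp
  rw [onePlusEps_conj, ← aeval_conj]
  apply hM
  rw [mem_ideal]
  intro a ha
  rw [aeval_conj]
  have := mem_ideal.1 hp (g * a * g⁻¹) (G.mul_mem (G.mul_mem hg ha) (G.inv_mem hg))
  simpa using this

/-- The tangent space at the identity, as a vector space. -/
def tangentSpace (G : Subgroup (GL ι K)) : Submodule K (Matrix ι ι K) where
  carrier := {N | IsTangent G N}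
  zero_mem' := by
    rw [Set.mem_ofPred_eq, isTangent_iff]
    intro p _
    simp [Matrix.entries]
  add_mem' := by
    intro M N hM hN
    rw [Set.mem_ofPred_eq, isTangent_iff] at *
    intro p hp
    have := congrArg₂ (· + ·) (hM p hp) (hN p hp)
    simpa [Matrix.entries, add_mul, Finset.sum_add_distrib] using this
  smul_mem' := by
    intro c M hM
    rw [Set.mem_ofPred_eq, isTangent_iff] at *
    intro p hp
    have := congrArg (c * ·) (hM p hp)
    simpa [Matrix.entries, mul_assoc, Finset.mul_sum] using this

theorem lie_mem_tangentSpace {G : Subgroup (GL ι K)} {N M : Matrix ι ι K}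
    (hN : N ∈ tangentSpace G) (hM : M ∈ tangentSpace G) : ⁅N, M⁆ ∈ tangentSpace G := by
  by_contra hc
  obtain ⟨f, hf, hle⟩ := Submodule.exists_le_ker_of_notMem hc
  have hf0 : ∀ B ∈ tangentSpace G, f B = 0 := fun B hB => hle hB
  have hsum : ∀ B : Matrix ι ι K, f B = ∑ i, ∑ j, f (Matrix.single i j 1) * B i j := by
    intro B
    conv_lhs => rw [Matrix.matrix_eq_sum_single B]
    simp only [map_sum]
    refine Finset.sum_congr rfl fun i _ => Finset.sum_congr rfl fun j _ => ?_
    have : Matrix.single i j (B i j) = B i j • Matrix.single i j (1 : K) := by simp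
    rw [this, map_smul, smul_eq_mul, mul_comm]
  let Y := Matrix.mvPolynomialX ι ι K
  let P : MvPolynomial (ι × ι) K :=
    ∑ i, ∑ j, C (f (Matrix.single i j 1)) *
      (Y * M.map (C : K → MvPolynomial (ι × ι) K) * Y.adjugate : Matrix ι ι _) i j
  have hP : ∀ {A : Type _} [CommRing A] [Algebra K A] (T : Matrix ι ι A),
      aeval T.entries P = ∑ i, ∑ j, algebraMap K A (f (Matrix.single i j 1)) *
        (T * M.map (algebraMap K A) * T.adjugate) i j := by
    intro A _ _ T
    have hY : (aeval T.entries : MvPolynomial (ι × ι) K →ₐ[K] A).mapMatrix Y = T := by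
      ext i j
      simp [Y, Matrix.entries, Matrix.mvPolynomialX_apply]
    have hMC : (aeval T.entries : MvPolynomial (ι × ι) K →ₐ[K] A).mapMatrix (M.map C) =
        M.map (algebraMap K A) := by
      ext i j
      simp
    have hall : (aeval T.entries : MvPolynomial (ι × ι) K →ₐ[K] A).mapMatrix
        (Y * M.map C * Y.adjugate) = T * M.map (algebraMap K A) * T.adjugate := by
      rw [map_mul, map_mul, hMC, AlgHom.map_adjugate, hY]
    rw [← hall]
    simp [P]
  have hPI : P ∈ ideal G := by
    rw [mem_ideal]
    intro g hg
    rw [hP]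
    have h1 := hsum (g.val * M * g.val.adjugate)
    have h2 : g.val * M * g.val.adjugate = g.val.det • (g.val * M * g⁻¹.val) := by
      have hd : g.val.det ≠ 0 := g.isUnit.map Matrix.detMonoidHom |>.ne_zero
      rw [Matrix.coe_units_inv, Matrix.inv_def, Ring.inverse_eq_inv']
      simp [smul_smul, hd]
    have h3 : f (g.val * M * g.val.adjugate) = 0 := by
      rw [h2, map_smul, hf0 _ (IsTangent.conj hM hg), smul_zero]
    rw [h1] at h3
    simpa using h3
  have key := hN P hPI
  rw [hP] at key
  let T := onePlusEps N
  let E : DualNumber K := DualNumber.eps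
  let N' := N.map (algebraMap K (DualNumber K))
  let M' := M.map (algebraMap K (DualNumber K))
  have hE : E * E = 0 := DualNumber.eps_mul_eps
  have hT : T = 1 + E • N' := rfl
  have hinv : T * (1 - E • N') = 1 := by
    rw [hT]
    simp [mul_sub, add_mul, smul_smul, hE]
  have hadj : T.adjugate = T.det • (1 - E • N') := by
    calc T.adjugate = T.adjugate * (T * (1 - E • N')) := by rw [hinv, mul_one]
      _ = _ := by rw [← mul_assoc, Matrix.adjugate_mul, Matrix.smul_mul, one_mul]
  have hconj : T * M' * T.adjugate = T.det • (M' + E • (⁅N, M⁆.map (algebraMap K _))) := by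
    rw [hadj, Matrix.mul_smul]
    congr 1
    have : ⁅N, M⁆.map (algebraMap K (DualNumber K)) = N' * M' - M' * N' := by
      rw [Ring.lie_def, Matrix.map_sub _ (map_sub _), Matrix.map_mul, Matrix.map_mul]
    rw [this, hT]
    simp [mul_sub, add_mul, smul_smul, hE, smul_sub]
    abel
  have hdet : IsUnit T.det := by
    refine IsUnit.of_mul_eq_one ((1 - E • N').det) ?_
    rw [← Matrix.det_mul, hinv, Matrix.det_one]
  have key2 : T.det * (algebraMap K (DualNumber K) (f M) +
      E * algebraMap K (DualNumber K) (f ⁅N, M⁆)) = 0 := by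
    rw [← key]
    change _ = ∑ i, ∑ j, algebraMap K (DualNumber K) (f (Matrix.single i j 1)) *
      (T * M' * T.adjugate) i j
    rw [hconj, hsum M, hsum ⁅N, M⁆]
    simp only [map_sum, map_mul, Finset.mul_sum, ← Finset.sum_add_distrib, mul_add,
      Matrix.smul_apply, Matrix.add_apply, smul_eq_mul, Matrix.map_apply, M']
    refine Finset.sum_congr rfl fun i _ => Finset.sum_congr rfl fun j _ => ?_
    ring
  rw [hdet.mul_right_eq_zero, hf0 M hM, map_zero, zero_add] at key2
  have := congrArg TrivSqZeroExt.snd key2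
  simp [E, TrivSqZeroExt.algebraMap_eq_inl] at this
  exact hf this

/-- The Lie algebra of the linear algebraic group `G`, as a Lie subalgebra of the matrices:
all `N` such that `Id + ε N` satisfies the equations of `G` modulo `ε²`. -/
def lieAlgebra (G : Subgroup (GL ι K)) : LieSubalgebra K (Matrix ι ι K) where
  toSubmodule := tangentSpace G
  lie_mem' := fun hN hM => lie_mem_tangentSpace hN hM

/-- A Lie algebra of matrices is algebraic if it is the Lie algebra of a linear algebraic
group. -/
def IsAlgebraicLie (h : LieSubalgebra K (Matrix ι ι K)) : Prop :=
  ∃ G : Subgroup (GL ι K), IsAlgebraicGroup G ∧ lieAlgebra G = h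

end Basic

section Blocks

variable {m n K : Type*} [Fintype m] [DecidableEq m] [Fintype n] [DecidableEq n] [Field K]

/-- All elements of `G` are block-diagonal, with diagonal blocks indexed by `m` and `n`. -/
def IsBlockDiagonal (G : Subgroup (GL (m ⊕ n) K)) : Prop :=
  ∀ g ∈ G, ∃ (A : Matrix m m K) (D : Matrix n n K), g.val = Matrix.fromBlocks A 0 0 D

/-- All matrices of `V` have the form `(0 0; X 0)`. -/
def IsLowerLeft (V : Submodule K (Matrix (m ⊕ n) (m ⊕ n) K)) : Prop :=
  ∀ B ∈ V, ∃ X : Matrix n m K, B = Matrix.fromBlocks 0 0 X 0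

theorem IsLowerLeft.mul_eq_zero {V : Submodule K (Matrix (m ⊕ n) (m ⊕ n) K)}
    (hV : IsLowerLeft V) {A B : Matrix (m ⊕ n) (m ⊕ n) K} (hA : A ∈ V) (hB : B ∈ V) :
    A * B = 0 := by
  obtain ⟨X, rfl⟩ := hV A hA
  obtain ⟨Y, rfl⟩ := hV B hB
  simp [Matrix.fromBlocks_multiply]

/-- The vector group `{Id + B | B ∈ V}`. -/
def vectorGroup (V : Submodule K (Matrix (m ⊕ n) (m ⊕ n) K)) (hV : IsLowerLeft V) :
    Subgroup (GL (m ⊕ n) K) where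
  carrier := {g | ∃ B ∈ V, g.val = 1 + B}
  one_mem' := ⟨0, V.zero_mem, by simp⟩
  mul_mem' := by
    rintro g h ⟨A, hA, hg⟩ ⟨B, hB, hh⟩
    refine ⟨A + B, V.add_mem hA hB, ?_⟩
    rw [Units.val_mul, hg, hh, add_mul, mul_add, mul_add, hV.mul_eq_zero hA hB]
    simp
    abel
  inv_mem' := by
    rintro g ⟨A, hA, hg⟩
    refine ⟨-A, V.neg_mem hA, ?_⟩
    refine Units.inv_eq_of_mul_eq_one_right ?_
    rw [hg, add_mul, mul_add, mul_add, hV.mul_eq_zero hA (V.neg_mem hA)]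
    simp

end Blocks

end LinAlgGroup

/-!
The key point is that a connected group `G` conjugates a space of matrices `W` into itself as soon
as its Lie algebra does. Let `F` be the ideal spanned by the equations of the stabilizer of `W`, and
`𝔪` the maximal ideal of the identity. The left invariant derivations along the Lie algebra of `G`
preserve `F`, and they combine into an Euler vector field that acts on the functions on `G`
vanishing to order `k` at the identity as multiplication by `k`, up to higher order, and maps `F`
into `𝔪 F`. Since `k` is invertible for `k ≥ 1`, this forces `F ≤ 𝔪 ^ k ⊔ I(G)` for all `k`, so by
Krull's intersection theorem `a F ≤ I(G)` for some `a` with `a(1) ≠ 0`. Hence `G` stabilizes `W`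
near the identity, and by connectedness everywhere.

Therefore `H = G (1 + W)`, and membership of `T` in `H` is polynomial: with `D` the block-diagonal
part of `T`, it says that the upper right block of `T` vanishes, `D ∈ G` and `adj(D) (T - D) ∈ W`.
On `1 + ε N` these equations split `N` into its block-diagonal part, tangent to `G`, and an element
of `W`.
-/

namespace LinAlgGroup

open MvPolynomial Topology Pointwise

section CommutativeAlgebra

theorem mul_mem_mul_sup {R : Type*} [CommRing R] {I J L : Ideal R} {a b : R} (ha : a ∈ I)
    (hb : b ∈ J ⊔ L) : a * b ∈ I * J ⊔ L := by
  obtain ⟨u, hu, v, hv, rfl⟩ := Submodule.mem_sup.1 hb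
  rw [mul_add]
  exact Submodule.add_mem_sup (Ideal.mul_mem_mul ha hu) (Ideal.mul_mem_left _ _ hv)

theorem exists_sub_one_mem_forall_mul_mem_of_le_pow_sup {R : Type*} [CommRing R]
    [IsNoetherianRing R] {𝔪 I F : Ideal R} (hF : ∀ k : ℕ, F ≤ 𝔪 ^ k ⊔ I) :
    ∃ r : R, r - 1 ∈ 𝔪 ∧ ∀ p ∈ F, r * p ∈ I := by
  have hpow (k : ℕ) : Submodule.map I.mkQ F ≤ 𝔪 ^ k • (⊤ : Submodule R (R ⧸ I)) := by
    have hmap := Submodule.map_mono (f := I.mkQ) (hF k)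
    rwa [Submodule.map_sup, Submodule.mkQ_map_self, sup_bot_eq, ← Ideal.mul_top (𝔪 ^ k),
      ← smul_eq_mul, Submodule.map_smul'', Submodule.map_top, Submodule.range_mkQ] at hmap
  obtain ⟨k, hk⟩ := 𝔪.exists_pow_inf_eq_pow_smul (Submodule.map I.mkQ F)
  have hsmul := hk (k + 1) k.le_succ
  rw [inf_eq_right.2 (hpow _), inf_eq_right.2 (hpow _), Nat.add_sub_cancel_left, pow_one] at hsmul
  obtain ⟨r, hr, hrF⟩ := Submodule.exists_sub_one_mem_and_smul_eq_zero_of_fg_of_le_smul 𝔪 _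
    (IsNoetherian.noetherian (Submodule.map I.mkQ F)) hsmul.le
  refine ⟨r, hr, fun p hp => (Submodule.Quotient.mk_eq_zero I).1 ?_⟩
  exact hrF _ (Submodule.mem_map_of_mem hp)

variable {K R : Type*} [CommRing R]

theorem derivation_sub_natCast_mul_mem_pow_sup [CommRing K] [Algebra K R] (E : Derivation K R R)
    {𝔪 I : Ideal R} (hI : ∀ p ∈ I, E p ∈ I) (hE : ∀ p ∈ 𝔪, E p - p ∈ 𝔪 ^ 2 ⊔ I) {k : ℕ} {p : R}
    (hp : p ∈ 𝔪 ^ (k + 1) ⊔ I) : E p - (k + 1 : ℕ) * p ∈ 𝔪 ^ (k + 2) ⊔ I := by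
  have hpow (k : ℕ) (p : R) (hp : p ∈ 𝔪 ^ (k + 1)) :
      E p - (k + 1 : ℕ) * p ∈ 𝔪 ^ (k + 2) ⊔ I := by
    induction k generalizing p with
    | zero => simpa using hE p (by simpa using hp)
    | succ k ih =>
      rw [pow_succ] at hp
      induction hp using Submodule.mul_induction_on' with
      | mem_mul_mem a ha b hb =>
        have leibniz : E (a * b) - (k + 1 + 1 : ℕ) * (a * b) =
            a * (E b - b) + b * (E a - (k + 1 : ℕ) * a) := by
          rw [E.leibniz, smul_eq_mul, smul_eq_mul]
          push_cast
          ring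
        rw [leibniz]
        refine Ideal.add_mem _ ?_ ?_
        · simpa only [← pow_add] using mul_mem_mul_sup ha (hE b hb)
        · simpa only [← pow_succ'] using mul_mem_mul_sup hb (ih a ha)
      | add a _ b _ iha ihb =>
        rw [map_add, mul_add, add_sub_add_comm]
        exact Ideal.add_mem _ iha ihb
  obtain ⟨u, hu, v, hv, rfl⟩ := Submodule.mem_sup.1 hp
  rw [map_add, mul_add, add_sub_add_comm]
  exact Ideal.add_mem _ (hpow k u hu)
    (Ideal.mem_sup_right (Ideal.sub_mem _ (hI v hv) (Ideal.mul_mem_left _ _ hv)))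

theorem le_pow_sup_of_derivation [Field K] [CharZero K] [Algebra K R] (E : Derivation K R R)
    {𝔪 I F : Ideal R} (hI : ∀ p ∈ I, E p ∈ I) (hE : ∀ p ∈ 𝔪, E p - p ∈ 𝔪 ^ 2 ⊔ I) (hF : F ≤ 𝔪)
    (hEF : ∀ p ∈ F, E p ∈ 𝔪 * F) (k : ℕ) : F ≤ 𝔪 ^ k ⊔ I := by
  induction k with
  | zero => simp
  | succ k ih =>
    cases k with
    | zero => exact hF.trans (by simp)
    | succ k =>
      intro p hp
      have hEp : E p ∈ 𝔪 ^ (k + 2) ⊔ I := by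
        refine (?_ : 𝔪 * F ≤ 𝔪 ^ (k + 2) ⊔ I) (hEF p hp)
        exact Ideal.mul_le.2 fun a ha b hb => by
          simpa only [← pow_succ'] using mul_mem_mul_sup ha (ih hb)
      have hmul : ((k + 1 : ℕ) : R) * p ∈ 𝔪 ^ (k + 2) ⊔ I := by
        have hdiff := derivation_sub_natCast_mul_mem_pow_sup E hI hE (ih hp)
        simpa only [sub_sub_cancel] using Ideal.sub_mem _ hEp hdiff
      have hunit : IsUnit ((k + 1 : ℕ) : R) := by
        rw [← map_natCast (algebraMap K R)]
        exact (IsUnit.mk0 _ (Nat.cast_ne_zero.2 k.succ_ne_zero)).map _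
      exact (Ideal.unit_mul_mem_iff_mem _ hunit).1 hmul

end CommutativeAlgebra

section Polynomials

variable {σ R : Type*} [CommRing R]

theorem sub_sub_sum_pderiv_mem_ker_sq [Fintype σ] (a : σ → R) (p : MvPolynomial σ R) :
    p - C (aeval a p) - ∑ x, C (aeval a (pderiv x p)) * (X x - C (a x)) ∈
      RingHom.ker (aeval (R := R) a) ^ 2 := by
  classical
  induction p using MvPolynomial.induction_on with
  | C c => simp
  | add p q hp hq =>
    convert! Ideal.add_mem _ hp hq using 1
    simp only [map_add, add_mul, Finset.sum_add_distrib]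
    ring
  | mul_X p x hp =>
    have hprod : (p - C (aeval a p)) * (X x - C (a x)) ∈ RingHom.ker (aeval (R := R) a) ^ 2 := by
      rw [pow_two]
      exact Ideal.mul_mem_mul (by simp) (by simp)
    have hsum : ∑ y, C (aeval a (pderiv y (p * X x))) * (X y - C (a y)) =
        C (aeval a p) * (X x - C (a x)) +
          C (a x) * ∑ y, C (aeval a (pderiv y p)) * (X y - C (a y)) := by
      simp [Derivation.leibniz, pderiv_X, Pi.single_apply, apply_ite, add_mul,
        Finset.sum_add_distrib, Finset.mul_sum, mul_assoc]
    convert! Ideal.add_mem _ hprod (Ideal.mul_mem_left _ (C (a x)) hp) using 1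
    rw [hsum, map_mul, aeval_X, map_mul]
    ring

theorem aeval_inl_add_inr {A : Type*} [CommRing A] [Algebra R A] (a : σ → A)
    (f : σ → MvPolynomial σ R) (p : MvPolynomial σ R) :
    aeval (fun x => TrivSqZeroExt.inl (a x) + TrivSqZeroExt.inr (aeval a (f x)) : σ → DualNumber A)
      p = TrivSqZeroExt.inl (aeval a p) + TrivSqZeroExt.inr (aeval a (mkDerivation R f p)) := by
  induction p using MvPolynomial.induction_on with
  | C c => simp [TrivSqZeroExt.algebraMap_eq_inl']
  | add p q hp hq =>
    simp only [map_add, hp, hq, TrivSqZeroExt.inl_add, TrivSqZeroExt.inr_add]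
    ring
  | mul_X p x hp =>
    rw [map_mul, hp, aeval_X, Derivation.leibniz, mkDerivation_X]
    ext <;> simp [mul_comm, add_comm]

theorem aeval_map_entries {ι A B : Type*} [CommRing A] [Algebra R A] [CommRing B] [Algebra R B]
    (f : A →ₐ[R] B) (T : Matrix ι ι A) (p : MvPolynomial (ι × ι) R) :
    aeval (T.map f).entries p = f (aeval T.entries p) :=
  (comp_aeval_apply T.entries f p).symm

end Polynomials

section Topology

variable {M : Type*} [TopologicalSpace M]

theorem isPreconnected_mul_of_one_mem [Monoid M] [ContinuousConstSMul M M] {s t : Set M}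
    (hs : IsPreconnected s) (ht : IsPreconnected t) (hs1 : 1 ∈ s) (ht1 : 1 ∈ t) :
    IsPreconnected (s * t) := by
  refine isPreconnected_of_forall 1 ?_
  rintro _ ⟨x, hx, y, hy, rfl⟩
  refine ⟨s ∪ x • t, Set.union_subset (Set.subset_mul_left s ht1) ?_, Or.inl hs1,
    Or.inr (Set.smul_mem_smul_set hy), ?_⟩
  · exact Set.smul_set_subset_mul hx
  · exact hs.union x hx ⟨1, ht1, mul_one x⟩ (ht.image _ (continuous_const_smul x).continuousOn)

theorem le_of_isPreconnected_of_inter_subset [Group M] [ContinuousConstSMul M M] {G : Subgroup M}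
    (hG : IsPreconnected (G : Set M)) {S : Submonoid M} (hS : IsClosed (S : Set M)) {U : Set M}
    (hU : IsOpen U) (hU1 : 1 ∈ U) (hUS : (G : Set M) ∩ U ⊆ S) : G.toSubmonoid ≤ S := by
  intro g hg
  by_contra hgS
  obtain ⟨x, hx, hxV, hxS⟩ := hG (⋃ h ∈ (G : Set M) ∩ S, h • U) (S : Set M)ᶜ
    (isOpen_biUnion fun h _ => hU.smul h) hS.isOpen_compl
    (fun x hx => (em (x ∈ S)).imp
      (fun hxS => Set.mem_biUnion ⟨hx, hxS⟩ ⟨1, hU1, mul_one x⟩) id)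
    ⟨1, G.one_mem, Set.mem_biUnion ⟨G.one_mem, S.one_mem⟩ ⟨1, hU1, mul_one 1⟩⟩ ⟨g, hg, hgS⟩
  obtain ⟨h, ⟨hhG, hhS⟩, u, hu, rfl⟩ := Set.mem_iUnion₂.1 hxV
  exact hxS (S.mul_mem hhS (hUS ⟨(G.mul_mem_cancel_left hhG).1 hx, hu⟩))

end Topology

section Zariski

variable {ι K : Type*} [Fintype ι] [DecidableEq ι] [Field K]

theorem isClosed_zariski_iff {Z : Set (GL ι K)} :
    IsClosed[zariski ι K] Z ↔ ∃ S : Set (MvPolynomial (ι × ι) K),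
      Z = {g : GL ι K | ∀ p ∈ S, aeval g.val.entries p = 0} := by
  have hIdeal : IsClosed[zariski ι K] Z ↔ ∃ I : Ideal (MvPolynomial (ι × ι) K),
      Z = {g : GL ι K | g.val.entries ∈ zeroLocus K I} := by
    rw [← @isOpen_compl_iff _ _ (zariski ι K)]
    change Zᶜᶜ ∈ _ ↔ _
    rw [compl_compl]
    rfl
  rw [hIdeal]
  constructor
  · rintro ⟨I, rfl⟩
    exact ⟨I, rfl⟩
  · rintro ⟨S, rfl⟩
    exact ⟨Ideal.span S, by simp only [zeroLocus_span]; rfl⟩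

theorem IsAlgebraicGroup.mem_of_forall_ideal {H : Subgroup (GL ι K)} (hH : IsAlgebraicGroup H)
    {g : GL ι K} (hg : ∀ p ∈ ideal H, aeval g.val.entries p = 0) : g ∈ H := by
  obtain ⟨S, hS⟩ := isClosed_zariski_iff.1 hH
  have hmem (h : GL ι K) : h ∈ H ↔ ∀ p ∈ S, aeval h.val.entries p = 0 := Set.ext_iff.1 hS h
  exact (hmem g).2 fun p hp => hg p (mem_ideal.2 fun h hh => (hmem h).1 hh p hp)

theorem aeval_mul_left (g h : GL ι K) (p : MvPolynomial (ι × ι) K) :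
    aeval h.val.entries (aeval (g.val.map C * Matrix.mvPolynomialX ι ι K *
      (1 : Matrix ι ι K).map C).entries p) = aeval (g * h).val.entries p := by
  rw [aeval_conj]
  simp

theorem continuous_mul_left_zariski (g : GL ι K) :
    @Continuous _ _ (zariski ι K) (zariski ι K) (g * ·) := by
  let := zariski ι K
  rw [continuous_iff_isClosed]
  intro Z hZ
  obtain ⟨S, rfl⟩ := isClosed_zariski_iff.1 hZ
  refine isClosed_zariski_iff.2 ⟨aeval (g.val.map C * Matrix.mvPolynomialX ι ι K *
    (1 : Matrix ι ι K).map C).entries '' S, ?_⟩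
  ext h
  simp only [Set.mem_preimage, Set.mem_ofPred_eq, Set.forall_mem_image, aeval_mul_left]

end Zariski

section InvariantDerivations

variable {ι K : Type*} [Fintype ι] [DecidableEq ι] [Field K]

/-- The left invariant derivation of the polynomial functions on matrices attached to `N`: the
derivative along the curves `g ↦ g (1 + ε N)`. -/
noncomputable def invDeriv (N : Matrix ι ι K) :
    Derivation K (MvPolynomial (ι × ι) K) (MvPolynomial (ι × ι) K) :=
  mkDerivation K (Matrix.mvPolynomialX ι ι K * N.map C).entries

theorem aeval_mul_onePlusEps (T N : Matrix ι ι K) (p : MvPolynomial (ι × ι) K) :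
    aeval (T.map (algebraMap K (DualNumber K)) * onePlusEps N).entries p =
      TrivSqZeroExt.inl (aeval T.entries p) +
        TrivSqZeroExt.inr (aeval T.entries (invDeriv N p)) := by
  rw [invDeriv, ← aeval_inl_add_inr]
  congr 2
  rw [onePlusEps, mul_add, mul_one, Matrix.mul_smul]
  ext x <;> simp [Matrix.entries, Matrix.mul_apply, Matrix.mvPolynomialX_apply,
    TrivSqZeroExt.algebraMap_eq_inl, ← TrivSqZeroExt.inl_mul, ← TrivSqZeroExt.inl_sum]

theorem invDeriv_mem_ideal {G : Subgroup (GL ι K)} {N : Matrix ι ι K} (hN : N ∈ tangentSpace G)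
    {p : MvPolynomial (ι × ι) K} (hp : p ∈ ideal G) : invDeriv N p ∈ ideal G := by
  rw [mem_ideal]
  intro g hg
  have htranslate : aeval (g.val.map C * Matrix.mvPolynomialX ι ι K *
      (1 : Matrix ι ι K).map C).entries p ∈ ideal G := by
    rw [mem_ideal]
    intro h hh
    rw [aeval_mul_left]
    exact mem_ideal.1 hp _ (G.mul_mem hg hh)
  have hzero := hN _ htranslate
  rw [aeval_conj, Matrix.map_one _ (map_zero _) (map_one _), mul_one, aeval_mul_onePlusEps] at hzero
  simpa using congrArg TrivSqZeroExt.snd hzero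

/-- The differential at the identity of a polynomial function on matrices. -/
noncomputable def differentialOne :
    MvPolynomial (ι × ι) K →ₗ[K] Module.Dual K (Matrix ι ι K) :=
  LinearMap.mk₂ K (fun p N => ∑ x, N.entries x * aeval (1 : Matrix ι ι K).entries (pderiv x p))
    (by intros; simp [mul_add, Finset.sum_add_distrib])
    (by intros; simp [Finset.mul_sum, mul_left_comm])
    (by intros; simp [Matrix.entries, add_mul, Finset.sum_add_distrib])
    (by intros; simp [Matrix.entries, Finset.mul_sum, mul_assoc])

theorem differentialOne_apply (p : MvPolynomial (ι × ι) K) (N : Matrix ι ι K) :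
    differentialOne p N =
      ∑ x, N.entries x * aeval (1 : Matrix ι ι K).entries (pderiv x p) := rfl

theorem differentialOne_single (p : MvPolynomial (ι × ι) K) (x : ι × ι) :
    differentialOne p (Matrix.single x.1 x.2 1) =
      aeval (1 : Matrix ι ι K).entries (pderiv x p) := by
  simp [differentialOne_apply, Matrix.entries, Matrix.single_apply, ← Prod.ext_iff]

theorem aeval_one_invDeriv (N : Matrix ι ι K) (p : MvPolynomial (ι × ι) K) :
    aeval (1 : Matrix ι ι K).entries (invDeriv N p) = differentialOne p N := by
  have h := aeval_mul_onePlusEps 1 N p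
  rw [Matrix.map_one _ (map_zero _) (map_one _), one_mul, aeval_onePlusEps] at h
  simpa [differentialOne_apply] using (congrArg TrivSqZeroExt.snd h).symm

theorem tangentSpace_eq_dualCoannihilator (G : Subgroup (GL ι K)) :
    tangentSpace G =
      (((ideal G).restrictScalars K).map differentialOne).dualCoannihilator := by
  ext N
  change IsTangent G N ↔ _
  simp [isTangent_iff, Submodule.mem_dualCoannihilator, differentialOne_apply]

theorem ideal_anti {G H : Subgroup (GL ι K)} (hGH : G ≤ H) : ideal H ≤ ideal G :=
  fun _ hp => mem_ideal.2 fun g hg => mem_ideal.1 hp g (hGH hg)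

theorem tangentSpace_mono {G H : Subgroup (GL ι K)} (hGH : G ≤ H) :
    tangentSpace G ≤ tangentSpace H :=
  fun _ hN p hp => hN p (ideal_anti hGH hp)

theorem mem_ideal_bot {p : MvPolynomial (ι × ι) K} :
    p ∈ ideal (⊥ : Subgroup (GL ι K)) ↔ aeval (1 : Matrix ι ι K).entries p = 0 := by
  simp [mem_ideal]

theorem X_sub_C_mem_ideal_bot (x : ι × ι) :
    X x - C ((1 : Matrix ι ι K).entries x) ∈ ideal (⊥ : Subgroup (GL ι K)) := by
  simp [mem_ideal_bot]

theorem mem_ideal_bot_sq_of_differentialOne_eq_zero {p : MvPolynomial (ι × ι) K}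
    (hp : p ∈ ideal (⊥ : Subgroup (GL ι K))) (hd : differentialOne p = 0) :
    p ∈ ideal (⊥ : Subgroup (GL ι K)) ^ 2 := by
  have hker : RingHom.ker (aeval (R := K) (1 : Matrix ι ι K).entries) =
      ideal (⊥ : Subgroup (GL ι K)) := Ideal.ext fun _ => mem_ideal_bot.symm
  have taylor := sub_sub_sum_pderiv_mem_ker_sq (1 : Matrix ι ι K).entries p
  simpa [hker, mem_ideal_bot.1 hp, ← differentialOne_single, hd] using taylor

theorem mem_ideal_bot_sq_sup_ideal {G : Subgroup (GL ι K)} {p : MvPolynomial (ι × ι) K}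
    (hp : p ∈ ideal (⊥ : Subgroup (GL ι K))) (hd : ∀ N ∈ tangentSpace G, differentialOne p N = 0) :
    p ∈ ideal (⊥ : Subgroup (GL ι K)) ^ 2 ⊔ ideal G := by
  have hdual : differentialOne p ∈ ((ideal G).restrictScalars K).map differentialOne := by
    rwa [← Subspace.dualCoannihilator_dualAnnihilator_eq
      (W := ((ideal G).restrictScalars K).map differentialOne),
      ← tangentSpace_eq_dualCoannihilator, Submodule.mem_dualAnnihilator]
  obtain ⟨q, hq, hqp⟩ := hdual
  have hdiff := mem_ideal_bot_sq_of_differentialOne_eq_zero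
    (Ideal.sub_mem _ hp (ideal_anti bot_le hq)) (by rw [map_sub, hqp, sub_self])
  simpa using Submodule.add_mem_sup hdiff hq

end InvariantDerivations

section Euler

variable {ι K : Type*} [Fintype ι] [DecidableEq ι] [Field K]

/-- The Euler vector field at the identity along the image of `π`. For a projection `π` onto the
tangent space of `G`, it acts on functions on `G` vanishing to order `k` at the identity as
multiplication by `k`, up to higher order. -/
noncomputable def euler (π : Matrix ι ι K →ₗ[K] Matrix ι ι K) :
    Derivation K (MvPolynomial (ι × ι) K) (MvPolynomial (ι × ι) K) :=
  ∑ x : ι × ι, (X x - C ((1 : Matrix ι ι K).entries x) : MvPolynomial (ι × ι) K) •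
    invDeriv (π (Matrix.single x.1 x.2 1))

theorem euler_apply (π : Matrix ι ι K →ₗ[K] Matrix ι ι K) (p : MvPolynomial (ι × ι) K) :
    euler π p = ∑ x : ι × ι, (X x - C ((1 : Matrix ι ι K).entries x)) *
      invDeriv (π (Matrix.single x.1 x.2 1)) p := by
  change Derivation.coeFnAddMonoidHom (euler π) p = _
  rw [euler, map_sum, Finset.sum_apply]
  rfl

variable {G : Subgroup (GL ι K)} {π : Matrix ι ι K →ₗ[K] Matrix ι ι K}

theorem euler_mem_ideal (hπ : ∀ N, π N ∈ tangentSpace G) {p : MvPolynomial (ι × ι) K}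
    (hp : p ∈ ideal G) : euler π p ∈ ideal G := by
  rw [euler_apply]
  exact Ideal.sum_mem _ fun x _ => Ideal.mul_mem_left _ _ (invDeriv_mem_ideal (hπ _) hp)

theorem differentialOne_euler (π : Matrix ι ι K →ₗ[K] Matrix ι ι K) (p : MvPolynomial (ι × ι) K) :
    differentialOne (euler π p) = differentialOne p ∘ₗ π := by
  refine LinearMap.ext fun N => ?_
  have hN : N = ∑ x : ι × ι, N.entries x • Matrix.single x.1 x.2 1 := by
    simpa [Fintype.sum_prod_type, Matrix.entries] using Matrix.matrix_eq_sum_single N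
  have hX (x : ι × ι) : aeval (1 : Matrix ι ι K).entries (invDeriv N (X x)) = N.entries x := by
    simp [aeval_one_invDeriv, differentialOne_apply, pderiv_X, Pi.single_apply, apply_ite]
  calc differentialOne (euler π p) N
      = ∑ x : ι × ι, N.entries x * differentialOne p (π (Matrix.single x.1 x.2 1)) := by
        simp_rw [← aeval_one_invDeriv, euler_apply, map_sum, Derivation.leibniz, map_add,
          smul_eq_mul, map_mul, map_sub, hX, aeval_X, derivation_C]
        simp [mul_comm]
    _ = differentialOne p (π (∑ x : ι × ι, N.entries x • Matrix.single x.1 x.2 1)) := by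
        simp only [map_sum, map_smul, smul_eq_mul]
    _ = (differentialOne p ∘ₗ π) N := by rw [← hN, LinearMap.comp_apply]

theorem euler_sub_mem (hπ : LinearMap.IsProj (tangentSpace G) π)
    {p : MvPolynomial (ι × ι) K} (hp : p ∈ ideal (⊥ : Subgroup (GL ι K))) :
    euler π p - p ∈ ideal (⊥ : Subgroup (GL ι K)) ^ 2 ⊔ ideal G := by
  refine mem_ideal_bot_sq_sup_ideal (Ideal.sub_mem _ ?_ hp) fun N hN => ?_
  · rw [euler_apply]
    exact Ideal.sum_mem _ fun x _ => Ideal.mul_mem_right _ _ (X_sub_C_mem_ideal_bot x)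
  · rw [map_sub, differentialOne_euler, LinearMap.sub_apply, LinearMap.comp_apply,
      hπ.map_id N hN, sub_self]

theorem exists_mul_mem_ideal_of_invDeriv_mem [CharZero K] {F : Ideal (MvPolynomial (ι × ι) K)}
    (hF : F ≤ ideal (⊥ : Subgroup (GL ι K)))
    (hD : ∀ N ∈ tangentSpace G, ∀ p ∈ F, invDeriv N p ∈ F) :
    ∃ a : MvPolynomial (ι × ι) K, aeval (1 : Matrix ι ι K).entries a ≠ 0 ∧
      ∀ p ∈ F, a * p ∈ ideal G := by
  obtain ⟨π, hπ⟩ : ∃ π, LinearMap.IsProj (tangentSpace G) π := by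
    obtain ⟨V, hV⟩ := (tangentSpace G).exists_isCompl
    exact ⟨(tangentSpace G).projection V hV, Submodule.projection_apply_mem hV,
      fun N hN => Submodule.projection_apply_of_mem_left hV hN⟩
  have hEF (p : MvPolynomial (ι × ι) K) (hp : p ∈ F) :
      euler π p ∈ ideal (⊥ : Subgroup (GL ι K)) * F := by
    rw [euler_apply]
    exact Ideal.sum_mem _ fun x _ =>
      Ideal.mul_mem_mul (X_sub_C_mem_ideal_bot x) (hD _ (hπ.map_mem _) p hp)
  obtain ⟨a, ha, haF⟩ := exists_sub_one_mem_forall_mul_mem_of_le_pow_sup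
    (le_pow_sup_of_derivation (euler π) (fun p => euler_mem_ideal hπ.map_mem)
      (fun p => euler_sub_mem hπ) hF hEF)
  refine ⟨a, ?_, haF⟩
  rw [mem_ideal_bot, map_sub, map_one, sub_eq_zero] at ha
  exact ha ▸ one_ne_zero

end Euler

section ConjPoly

variable {ι R : Type*} [Fintype ι] [DecidableEq ι] [CommRing R]

/-- The polynomial function `g ↦ tr (Φ g B adj(g))`. On invertible `g` its zeros are those of
`tr (Φ g B g⁻¹)`. -/
noncomputable def conjPoly (Φ B : Matrix ι ι R) : MvPolynomial (ι × ι) R :=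
  (Φ.map C * (Matrix.mvPolynomialX ι ι R * B.map C *
    (Matrix.mvPolynomialX ι ι R).adjugate)).trace

theorem aeval_conjPoly {A : Type*} [CommRing A] [Algebra R A] (Φ B : Matrix ι ι R)
    (T : Matrix ι ι A) :
    aeval T.entries (conjPoly Φ B) = (Φ.map (algebraMap R A) *
      (T * B.map (algebraMap R A) * T.adjugate)).trace := by
  have hX : (aeval (R := R) T.entries).mapMatrix (Matrix.mvPolynomialX ι ι R) = T :=
    Matrix.mvPolynomialX_mapMatrix_aeval R T
  have hC (M : Matrix ι ι R) :
      (aeval (R := R) T.entries).mapMatrix (M.map C) = M.map (algebraMap R A) := by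
    ext
    simp
  calc aeval T.entries (conjPoly Φ B)
      = ((aeval (R := R) T.entries).mapMatrix (Φ.map C * (Matrix.mvPolynomialX ι ι R * B.map C *
          (Matrix.mvPolynomialX ι ι R).adjugate))).trace :=
        AddMonoidHom.map_trace (aeval (R := R) T.entries) _
    _ = _ := by rw [map_mul, map_mul, map_mul, AlgHom.map_adjugate, hX, hC, hC]

end ConjPoly

section TraceForms

theorem mem_iff_forall_trace_mul_eq_zero {ι K : Type*} [Fintype ι] [Field K]
    {W : Submodule K (Matrix ι ι K)} {B : Matrix ι ι K} :
    B ∈ W ↔ ∀ Φ : Matrix ι ι K, (∀ B' ∈ W, (Φ * B').trace = 0) → (Φ * B).trace = 0 := by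
  classical
  refine ⟨fun hB Φ hΦ => hΦ B hB, fun h => ?_⟩
  by_contra hB
  obtain ⟨f, hfB, hfW⟩ := Submodule.exists_le_ker_of_notMem hB
  have hf (M : Matrix ι ι K) :
      (Matrix.of (fun i j => f (Matrix.single j i 1)) * M).trace = f M := by
    conv_rhs => rw [Matrix.matrix_eq_sum_single M]
    simp only [Matrix.trace, Matrix.diag_apply, Matrix.mul_apply, Matrix.of_apply, map_sum]
    rw [Finset.sum_comm]
    refine Finset.sum_congr rfl fun i _ => Finset.sum_congr rfl fun j _ => ?_
    rw [← mul_one (M i j), ← smul_eq_mul (M i j), ← Matrix.smul_single, map_smul, smul_eq_mul,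
      smul_eq_mul, mul_one, mul_comm]
  exact hfB (hf B ▸ h _ fun M hM => hf M ▸ hfW hM)

variable {ι K : Type*} [Fintype ι] [DecidableEq ι] [Field K]

theorem adjugate_eq_det_smul_inv (g : GL ι K) : g.val.adjugate = g.val.det • g⁻¹.val := by
  rw [Matrix.coe_units_inv, Matrix.inv_def, Ring.inverse_eq_inv',
    smul_inv_smul₀ (Matrix.GeneralLinearGroup.det_ne_zero g)]

theorem aeval_conjPoly_eq_zero_iff (Φ B : Matrix ι ι K) (g : GL ι K) :
    aeval g.val.entries (conjPoly Φ B) = 0 ↔ (Φ * (g.val * B * g⁻¹.val)).trace = 0 := by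
  have hdet : g.val.det ≠ 0 := Matrix.GeneralLinearGroup.det_ne_zero g
  simp [aeval_conjPoly, adjugate_eq_det_smul_inv, hdet, Algebra.algebraMap_self]

theorem adjugate_onePlusEps (N : Matrix ι ι K) :
    (onePlusEps N).adjugate = (1 + DualNumber.eps * algebraMap K (DualNumber K) N.trace) •
      (1 - (DualNumber.eps : DualNumber K) • N.map (algebraMap K (DualNumber K))) := by
  have heps : (DualNumber.eps : DualNumber K) * DualNumber.eps = 0 := DualNumber.eps_mul_eps
  have hinv : onePlusEps N *
      (1 - (DualNumber.eps : DualNumber K) • N.map (algebraMap K (DualNumber K))) = 1 := by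
    simp [onePlusEps, mul_sub, add_mul, smul_smul, heps]
  have hdet : (onePlusEps N).det = 1 + DualNumber.eps * algebraMap K (DualNumber K) N.trace := by
    have htrace := AddMonoidHom.map_trace (algebraMap K (DualNumber K)) N
    rw [onePlusEps, Matrix.det_one_add_smul, htrace, pow_two, heps]
    simp [mul_comm]
  rw [← hdet, ← one_mul (1 - _), ← Matrix.smul_mul, ← Matrix.adjugate_mul, mul_assoc, hinv, mul_one]

theorem adjugate_onePlusEps_mul_eps_smul (N : Matrix ι ι K) (T : Matrix ι ι (DualNumber K)) :
    (onePlusEps N).adjugate * ((DualNumber.eps : DualNumber K) • T) =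
      (DualNumber.eps : DualNumber K) • T := by
  have heps : (DualNumber.eps : DualNumber K) * DualNumber.eps = 0 := DualNumber.eps_mul_eps
  rw [adjugate_onePlusEps, Matrix.mul_smul, Matrix.smul_mul, smul_smul, mul_add, ← mul_assoc, heps]
  simp [sub_mul, smul_sub, smul_smul, heps]

theorem onePlusEps_mul_mul_adjugate (N B : Matrix ι ι K) :
    onePlusEps N * B.map (algebraMap K (DualNumber K)) * (onePlusEps N).adjugate =
      (1 + DualNumber.eps * algebraMap K (DualNumber K) N.trace) •
        (B.map (algebraMap K (DualNumber K)) +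
          (DualNumber.eps : DualNumber K) • ⁅N, B⁆.map (algebraMap K (DualNumber K))) := by
  rw [adjugate_onePlusEps, Matrix.mul_smul]
  congr 1
  rw [Ring.lie_def, Matrix.map_sub _ (map_sub _), Matrix.map_mul, Matrix.map_mul, onePlusEps]
  simp only [add_mul, one_mul, mul_sub, mul_one, Matrix.smul_mul, Matrix.mul_smul, smul_smul,
    DualNumber.eps_mul_eps, zero_smul, smul_sub]
  abel

theorem invDeriv_conjPoly [Infinite K] (Φ N B : Matrix ι ι K) :
    invDeriv N (conjPoly Φ B) = conjPoly Φ ⁅N, B⁆ + C N.trace * conjPoly Φ B := by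
  refine MvPolynomial.funext fun x => ?_
  let T : Matrix ι ι K := Matrix.of fun i j => x (i, j)
  have hconst (M : Matrix ι ι K) : (Φ.map (algebraMap K (DualNumber K)) *
      (T.map (algebraMap K (DualNumber K)) * M.map (algebraMap K (DualNumber K)) *
        (T.map (algebraMap K (DualNumber K))).adjugate)).trace =
      algebraMap K (DualNumber K) (aeval T.entries (conjPoly Φ M)) := by
    rw [← aeval_conjPoly, ← aeval_algebraMap_apply]
    rfl
  have hassoc (P Q R S U : Matrix ι ι (DualNumber K)) :
      P * Q * R * (S * U) = P * (Q * R * S) * U := by simp only [mul_assoc]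
  have hcurve := aeval_mul_onePlusEps T N (conjPoly Φ B)
  rw [aeval_conjPoly, Matrix.adjugate_mul_distrib, hassoc, onePlusEps_mul_mul_adjugate] at hcurve
  simp only [Matrix.mul_smul, Matrix.smul_mul, mul_add, add_mul, Matrix.trace_smul,
    Matrix.trace_add, hconst] at hcurve
  have hcoeff : aeval T.entries (invDeriv N (conjPoly Φ B)) =
      aeval T.entries (conjPoly Φ ⁅N, B⁆) + N.trace * aeval T.entries (conjPoly Φ B) := by
    simpa [TrivSqZeroExt.algebraMap_eq_inl] using (congrArg TrivSqZeroExt.snd hcurve).symm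
  rw [map_add, map_mul, eval_C, ← coe_aeval_eq_eval]
  exact hcoeff

end TraceForms

section Stabilizer

variable {ι K : Type*} [Fintype ι] [DecidableEq ι] [Field K]

/-- The matrices that conjugate `W` into itself. -/
def conjStabilizer (W : Submodule K (Matrix ι ι K)) : Submonoid (GL ι K) where
  carrier := {g | ∀ B ∈ W, g.val * B * g⁻¹.val ∈ W}
  one_mem' := fun B hB => by simpa using hB
  mul_mem' := fun {g h} hg hh B hB => by simpa [mul_assoc] using hg _ (hh B hB)

/-- The equations of `conjStabilizer W`. -/
def conjEquations (W : Submodule K (Matrix ι ι K)) : Set (MvPolynomial (ι × ι) K) :=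
  {p | ∃ Φ B : Matrix ι ι K, (∀ B' ∈ W, (Φ * B').trace = 0) ∧ B ∈ W ∧ conjPoly Φ B = p}

theorem mem_conjStabilizer_iff_conjEquations {W : Submodule K (Matrix ι ι K)} {g : GL ι K} :
    g ∈ conjStabilizer W ↔ ∀ p ∈ conjEquations W, aeval g.val.entries p = 0 := by
  constructor
  · rintro hg _ ⟨Φ, B, hΦ, hB, rfl⟩
    exact (aeval_conjPoly_eq_zero_iff Φ B g).2 (hΦ _ (hg B hB))
  · intro hg B hB
    rw [mem_iff_forall_trace_mul_eq_zero]
    exact fun Φ hΦ => (aeval_conjPoly_eq_zero_iff Φ B g).1 (hg _ ⟨Φ, B, hΦ, hB, rfl⟩)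

theorem isClosed_conjStabilizer (W : Submodule K (Matrix ι ι K)) :
    IsClosed[zariski ι K] (conjStabilizer W : Set (GL ι K)) :=
  isClosed_zariski_iff.2
    ⟨conjEquations W, Set.ext fun _ => mem_conjStabilizer_iff_conjEquations⟩

theorem invDeriv_mem_span_conjEquations [Infinite K] {W : Submodule K (Matrix ι ι K)}
    {N : Matrix ι ι K} (hN : ∀ B ∈ W, ⁅N, B⁆ ∈ W) {p : MvPolynomial (ι × ι) K}
    (hp : p ∈ Ideal.span (conjEquations W)) : invDeriv N p ∈ Ideal.span (conjEquations W) := by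
  induction hp using Submodule.span_induction with
  | mem p hp =>
    obtain ⟨Φ, B, hΦ, hB, rfl⟩ := hp
    rw [invDeriv_conjPoly]
    exact Ideal.add_mem _ (Ideal.subset_span ⟨Φ, _, hΦ, hN B hB, rfl⟩)
      (Ideal.mul_mem_left _ _ (Ideal.subset_span ⟨Φ, B, hΦ, hB, rfl⟩))
  | zero => simp
  | add p q _ _ hp hq => simpa using Ideal.add_mem _ hp hq
  | smul c p hp hDp =>
    rw [smul_eq_mul, Derivation.leibniz]
    exact Ideal.add_mem _ (Ideal.mul_mem_left _ _ hDp) (Ideal.mul_mem_right _ _ hp)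

theorem le_conjStabilizer_of_lie_mem [CharZero K] {G : Subgroup (GL ι K)}
    (hG : IsZariskiConnected G) {W : Submodule K (Matrix ι ι K)}
    (hW : ∀ N ∈ tangentSpace G, ∀ B ∈ W, ⁅N, B⁆ ∈ W) : G.toSubmonoid ≤ conjStabilizer W := by
  let := zariski ι K
  have : ContinuousConstSMul (GL ι K) (GL ι K) := ⟨continuous_mul_left_zariski⟩
  have hone : Ideal.span (conjEquations W) ≤ ideal (⊥ : Subgroup (GL ι K)) :=
    Ideal.span_le.2 fun p hp => mem_ideal_bot.2 <| by
      simpa using mem_conjStabilizer_iff_conjEquations.1 (conjStabilizer W).one_mem p hp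
  obtain ⟨a, ha1, ha⟩ := exists_mul_mem_ideal_of_invDeriv_mem hone
    fun N hN _ => invDeriv_mem_span_conjEquations (hW N hN)
  have hU : IsOpen {g : GL ι K | aeval g.val.entries a ≠ 0} :=
    isClosed_compl_iff.1 (isClosed_zariski_iff.2 ⟨{a}, by ext; simp⟩)
  refine le_of_isPreconnected_of_inter_subset hG.isPreconnected (isClosed_conjStabilizer W) hU
    (by simpa using ha1) ?_
  rintro g ⟨hg, hga⟩
  refine mem_conjStabilizer_iff_conjEquations.2 fun p hp => ?_
  have hap := mem_ideal.1 (ha p (Ideal.subset_span hp)) g hg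
  rw [map_mul] at hap
  exact (mul_eq_zero.1 hap).resolve_left hga

end Stabilizer

section Lines

variable {ι R : Type*} [DecidableEq ι] [CommRing R]

/-- The line `t ↦ 1 + t B` through the identity, as a matrix over the polynomials in `t`. -/
noncomputable def line (B : Matrix ι ι R) : Matrix ι ι (Polynomial R) :=
  1 + (Polynomial.X : Polynomial R) • B.map Polynomial.C

theorem line_map_aeval {A : Type*} [CommRing A] [Algebra R A] (B : Matrix ι ι R) (a : A) :
    (line B).map (Polynomial.aeval a) = 1 + a • B.map (algebraMap R A) := by
  ext i j
  simp only [line, Matrix.map_apply, Matrix.add_apply, Matrix.smul_apply, smul_eq_mul, map_add,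
    map_mul, Matrix.one_apply, apply_ite, map_one, map_zero, Polynomial.aeval_X, Polynomial.aeval_C]

/-- `1 + B`, as an element of the general linear group when `B² = 0`. -/
def onePlus [Fintype ι] (B : Matrix ι ι R) (hB : B * B = 0) : GL ι R where
  val := 1 + B
  inv := 1 - B
  val_inv := by simp [mul_sub, add_mul, hB]
  inv_val := by simp [mul_add, sub_mul, hB]

end Lines

section PolynomialCurves

variable {ι K : Type*} [Fintype ι] [DecidableEq ι] [Field K]

theorem isPreconnected_range_of_polynomial [Infinite K] {M : Matrix ι ι (Polynomial K)}
    {γ : K → GL ι K} (hγ : ∀ t, (γ t).val = M.map (Polynomial.aeval t)) :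
    @IsPreconnected _ (zariski ι K) (Set.range γ) := by
  let := zariski ι K
  refine (isPreirreducible_iff_isClosed_union_isClosed.2 fun Z₁ Z₂ hZ₁ hZ₂ hZ => ?_).isPreconnected
  obtain ⟨S₁, rfl⟩ := isClosed_zariski_iff.1 hZ₁
  obtain ⟨S₂, rfl⟩ := isClosed_zariski_iff.1 hZ₂
  have heval (t : K) (p : MvPolynomial (ι × ι) K) :
      aeval (γ t).val.entries p = (aeval M.entries p).eval t := by
    rw [hγ, aeval_map_entries, Polynomial.coe_aeval_eq_eval]
  by_contra! hnot
  simp only [Set.not_subset, Set.exists_range_iff, Set.mem_ofPred_eq, not_forall, heval] at hnot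
  obtain ⟨⟨t₁, p₁, hp₁, ht₁⟩, ⟨t₂, p₂, hp₂, ht₂⟩⟩ := hnot
  have hprod : aeval M.entries p₁ * aeval M.entries p₂ = 0 := Polynomial.funext fun t => by
    have hcases := hZ (Set.mem_range_self t)
    simp only [Set.mem_union, Set.mem_ofPred_eq, heval] at hcases
    rw [Polynomial.eval_mul, Polynomial.eval_zero, mul_eq_zero]
    exact hcases.imp (· p₁ hp₁) (· p₂ hp₂)
  rcases mul_eq_zero.1 hprod with h | h
  · exact ht₁ (by rw [h, Polynomial.eval_zero])
  · exact ht₂ (by rw [h, Polynomial.eval_zero])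

theorem mem_tangentSpace_of_forall_line [Infinite K] {G : Subgroup (GL ι K)} {B : Matrix ι ι K}
    (hB : ∀ t : K, ∃ g ∈ G, g.val = 1 + t • B) : B ∈ tangentSpace G := by
  intro p hp
  have hline : aeval (line B).entries p = 0 := Polynomial.funext fun t => by
    obtain ⟨g, hg, hgt⟩ := hB t
    rw [← Polynomial.coe_aeval_eq_eval, ← aeval_map_entries, line_map_aeval]
    simpa [Algebra.algebraMap_self, ← hgt] using mem_ideal.1 hp g hg
  have heps := aeval_map_entries (Polynomial.aeval (DualNumber.eps : DualNumber K)) (line B) p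
  rwa [line_map_aeval, hline, map_zero] at heps

end PolynomialCurves

section VectorGroups

variable {m n K : Type*} [Fintype m] [DecidableEq m] [Fintype n] [DecidableEq n] [Field K]
  {W : Submodule K (Matrix (m ⊕ n) (m ⊕ n) K)}

theorem isPreconnected_vectorGroup [Infinite K] (hW : IsLowerLeft W) :
    @IsPreconnected _ (zariski (m ⊕ n) K) (vectorGroup W hW : Set (GL (m ⊕ n) K)) := by
  let := zariski (m ⊕ n) K
  refine isPreconnected_of_forall 1 ?_
  rintro g ⟨B, hB, hg⟩
  have hsq (t : K) : (t • B) * (t • B) = 0 :=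
    hW.mul_eq_zero (W.smul_mem t hB) (W.smul_mem t hB)
  refine ⟨Set.range fun t => onePlus (t • B) (hsq t), ?_, ⟨0, ?_⟩, ⟨1, ?_⟩,
    isPreconnected_range_of_polynomial (M := line B) fun t => ?_⟩
  · rintro _ ⟨t, rfl⟩
    exact ⟨t • B, W.smul_mem t hB, rfl⟩
  · ext1
    simp [onePlus]
  · ext1
    simp [onePlus, hg]
  · rw [line_map_aeval, Algebra.algebraMap_self]
    rfl

theorem le_tangentSpace_vectorGroup [Infinite K] (hW : IsLowerLeft W) :
    W ≤ tangentSpace (vectorGroup W hW) := fun B hB => mem_tangentSpace_of_forall_line fun t =>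
  have htB := W.smul_mem t hB
  ⟨onePlus (t • B) (hW.mul_eq_zero htB htB), ⟨t • B, htB, rfl⟩, rfl⟩

end VectorGroups

section DiagPart

variable {m n : Type*}

/-- The block-diagonal part of a matrix. -/
def diagPart {A : Type*} [Zero A] (T : Matrix (m ⊕ n) (m ⊕ n) A) : Matrix (m ⊕ n) (m ⊕ n) A :=
  Matrix.fromBlocks T.toBlocks₁₁ 0 0 T.toBlocks₂₂

theorem diagPart_map {A B F : Type*} [Zero A] [Zero B] [FunLike F A B] [ZeroHomClass F A B]
    (f : F) (T : Matrix (m ⊕ n) (m ⊕ n) A) : (diagPart T).map f = diagPart (T.map f) := by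
  rw [diagPart, Matrix.fromBlocks_map, Matrix.map_zero _ (map_zero f),
    Matrix.map_zero _ (map_zero f)]
  rfl

theorem diagPart_fromBlocks {A : Type*} [Zero A] (P : Matrix m m A) (Q : Matrix m n A)
    (R : Matrix n m A) (S : Matrix n n A) :
    diagPart (Matrix.fromBlocks P Q R S) = Matrix.fromBlocks P 0 0 S := rfl

theorem diagPart_onePlusEps [DecidableEq m] [DecidableEq n] {K : Type*} [Field K]
    (N : Matrix (m ⊕ n) (m ⊕ n) K) :
    diagPart (onePlusEps N) = onePlusEps (diagPart N) := by
  ext (i | i) (j | j) <;>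
    simp [diagPart, onePlusEps, Matrix.toBlocks₁₁, Matrix.toBlocks₂₂, Matrix.one_apply]

theorem det_diagPart_of_toBlocks₁₂_eq_zero [Fintype m] [DecidableEq m] [Fintype n] [DecidableEq n]
    {A : Type*} [CommRing A] {T : Matrix (m ⊕ n) (m ⊕ n) A} (hT : T.toBlocks₁₂ = 0) :
    (diagPart T).det = T.det := by
  conv_rhs => rw [← Matrix.fromBlocks_toBlocks T, hT, Matrix.det_fromBlocks_zero₁₂]
  rw [diagPart, Matrix.det_fromBlocks_zero₁₂]

theorem lie_fromBlocks_diagonal_lowerLeft [Fintype m] [Fintype n] {A : Type*} [Ring A]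
    (N₁ : Matrix m m A) (N₂ : Matrix n n A) (X : Matrix n m A) :
    ⁅Matrix.fromBlocks N₁ 0 0 N₂, (Matrix.fromBlocks 0 0 X 0 : Matrix (m ⊕ n) (m ⊕ n) A)⁆ =
      Matrix.fromBlocks 0 0 (N₂ * X - X * N₁) 0 := by
  rw [Ring.lie_def, Matrix.fromBlocks_multiply, Matrix.fromBlocks_multiply, sub_eq_add_neg,
    Matrix.fromBlocks_neg, Matrix.fromBlocks_add]
  simp [sub_eq_add_neg]

section Evaluation

variable {R A : Type*} [CommRing R] [CommRing A] [Algebra R A] (T : Matrix (m ⊕ n) (m ⊕ n) A)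

theorem diagPart_mvPolynomialX_map_aeval :
    (diagPart (Matrix.mvPolynomialX (m ⊕ n) (m ⊕ n) R)).map (aeval T.entries) = diagPart T := by
  rw [diagPart_map]
  congr 1
  ext
  simp [Matrix.entries]

theorem aeval_aeval_diagPart (p : MvPolynomial ((m ⊕ n) × (m ⊕ n)) R) :
    aeval T.entries (aeval (diagPart (Matrix.mvPolynomialX (m ⊕ n) (m ⊕ n) R)).entries p) =
      aeval (diagPart T).entries p := by
  rw [← aeval_map_entries, diagPart_mvPolynomialX_map_aeval]

end Evaluation

end DiagPart

section LowerPoly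

variable {m n R : Type*} [Fintype m] [DecidableEq m] [Fintype n] [DecidableEq n] [CommRing R]

/-- The polynomial function `T ↦ tr (Φ adj(D) (T - D))`, where `D` is the block-diagonal part of
`T`. For `T = h (1 + B)` with `h` block-diagonal invertible and `B` lower left, its zeros are
those of `tr (Φ B)`. -/
noncomputable def lowerPoly (Φ : Matrix (m ⊕ n) (m ⊕ n) R) :
    MvPolynomial ((m ⊕ n) × (m ⊕ n)) R :=
  let T := Matrix.mvPolynomialX (m ⊕ n) (m ⊕ n) R
  (Φ.map C * ((diagPart T).adjugate * (T - diagPart T))).trace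

theorem aeval_lowerPoly {A : Type*} [CommRing A] [Algebra R A] (T : Matrix (m ⊕ n) (m ⊕ n) A)
    (Φ : Matrix (m ⊕ n) (m ⊕ n) R) :
    aeval T.entries (lowerPoly Φ) =
      (Φ.map (algebraMap R A) * ((diagPart T).adjugate * (T - diagPart T))).trace := by
  have hΦ : (aeval (R := R) T.entries).mapMatrix (Φ.map C) = Φ.map (algebraMap R A) := by
    ext
    simp
  have hX : (aeval (R := R) T.entries).mapMatrix (Matrix.mvPolynomialX (m ⊕ n) (m ⊕ n) R) = T :=
    Matrix.mvPolynomialX_mapMatrix_aeval R T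
  have hdiag : (aeval (R := R) T.entries).mapMatrix
      (diagPart (Matrix.mvPolynomialX (m ⊕ n) (m ⊕ n) R)) = diagPart T :=
    diagPart_mvPolynomialX_map_aeval T
  refine (AddMonoidHom.map_trace (aeval (R := R) T.entries) _).trans (congrArg Matrix.trace ?_)
  change (aeval (R := R) T.entries).mapMatrix _ = _
  rw [map_mul, map_mul, map_sub, AlgHom.map_adjugate, hΦ, hdiag, hX]

end LowerPoly

section SemidirectProduct

variable {m n K : Type*} [Fintype m] [DecidableEq m] [Fintype n] [DecidableEq n] [Field K]
  {G : Subgroup (GL (m ⊕ n) K)} {W : Submodule K (Matrix (m ⊕ n) (m ⊕ n) K)}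

theorem coe_sup_vectorGroup (hW : IsLowerLeft W) (hGW : G.toSubmonoid ≤ conjStabilizer W) :
    ((G ⊔ vectorGroup W hW : Subgroup (GL (m ⊕ n) K)) : Set (GL (m ⊕ n) K)) =
      (G : Set (GL (m ⊕ n) K)) * (vectorGroup W hW : Set (GL (m ⊕ n) K)) := by
  have hconj (h : GL (m ⊕ n) K) (hh : h ∈ G) (v : GL (m ⊕ n) K) (hv : v ∈ vectorGroup W hW) :
      h * v * h⁻¹ ∈ vectorGroup W hW := by
    obtain ⟨B, hB, hvB⟩ := hv
    refine ⟨_, hGW hh B hB, ?_⟩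
    rw [Units.val_mul, Units.val_mul, hvB, mul_add, add_mul, mul_one, ← Units.val_mul,
      mul_inv_cancel, Units.val_one]
  refine Subgroup.coe_mul_of_left_le_normalizer_right _ _ fun h hh => ?_
  refine Subgroup.mem_normalizer_iff.2 fun v => ⟨hconj h hh v, fun hv => ?_⟩
  simpa [mul_assoc] using hconj h⁻¹ (G.inv_mem hh) _ hv

theorem mem_sup_vectorGroup_iff (hW : IsLowerLeft W) (hGW : G.toSubmonoid ≤ conjStabilizer W)
    {g : GL (m ⊕ n) K} :
    g ∈ G ⊔ vectorGroup W hW ↔ ∃ h ∈ G, ∃ B ∈ W, g.val = h.val * (1 + B) := by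
  rw [← SetLike.mem_coe, coe_sup_vectorGroup hW hGW, Set.mem_mul]
  constructor
  · rintro ⟨h, hh, v, ⟨B, hB, hv⟩, rfl⟩
    exact ⟨h, hh, B, hB, by rw [Units.val_mul, hv]⟩
  · rintro ⟨h, hh, B, hB, hg⟩
    exact ⟨h, hh, onePlus B (hW.mul_eq_zero hB hB), ⟨B, hB, rfl⟩, Units.ext hg.symm⟩

/-- The equations of the group of all `h (1 + B)` with `h ∈ G` block-diagonal and `B ∈ W` lower
left. -/
def blockEquations (G : Subgroup (GL (m ⊕ n) K)) (W : Submodule K (Matrix (m ⊕ n) (m ⊕ n) K)) :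
    Set (MvPolynomial ((m ⊕ n) × (m ⊕ n)) K) :=
  aeval (diagPart (Matrix.mvPolynomialX (m ⊕ n) (m ⊕ n) K)).entries '' {p | p ∈ ideal G} ∪
    Set.range (fun x : m × n => X (Sum.inl x.1, Sum.inr x.2)) ∪
    lowerPoly '' {Φ | ∀ B ∈ W, (Φ * B).trace = 0}

theorem blockEquations_subset_ideal (hG : IsBlockDiagonal G) (hW : IsLowerLeft W)
    (hGW : G.toSubmonoid ≤ conjStabilizer W) :
    blockEquations G W ⊆ ideal (G ⊔ vectorGroup W hW) := by
  intro q hq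
  refine mem_ideal.2 fun g hg => ?_
  obtain ⟨h, hh, B, hB, hghB⟩ := (mem_sup_vectorGroup_iff hW hGW).1 hg
  obtain ⟨P, S, hPS⟩ := hG h hh
  obtain ⟨Z, hZ⟩ := hW B hB
  have hblocks : g.val = Matrix.fromBlocks P 0 (S * Z) S := by
    rw [hghB, mul_add, mul_one, hPS, hZ, Matrix.fromBlocks_multiply, Matrix.fromBlocks_add]
    simp
  have hdiag : diagPart g.val = h.val := by rw [hblocks, diagPart_fromBlocks, hPS]
  obtain (⟨p, hp, rfl⟩ | ⟨⟨i, j⟩, rfl⟩) | ⟨Φ, hΦ, rfl⟩ := hq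
  · rw [aeval_aeval_diagPart, hdiag]
    exact mem_ideal.1 hp h hh
  · simp [Matrix.entries, hblocks]
  · have hadj : h.val.adjugate * (g.val - h.val) = h.val.det • B := by
      rw [hghB, mul_add, mul_one, add_sub_cancel_left, ← mul_assoc, Matrix.adjugate_mul,
        Matrix.smul_mul, one_mul]
    rw [aeval_lowerPoly, hdiag, hadj]
    simp [Algebra.algebraMap_self, hΦ B hB]

theorem mem_sup_vectorGroup_of_blockEquations (hG : IsAlgebraicGroup G) (hW : IsLowerLeft W)
    (hGW : G.toSubmonoid ≤ conjStabilizer W) {g : GL (m ⊕ n) K}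
    (hg : ∀ q ∈ blockEquations G W, aeval g.val.entries q = 0) : g ∈ G ⊔ vectorGroup W hW := by
  have hupper : g.val.toBlocks₁₂ = 0 := Matrix.ext fun i j => by
    simpa [Matrix.entries, Matrix.toBlocks₁₂] using hg _ (Or.inl (Or.inr ⟨(i, j), rfl⟩))
  have hdet : (diagPart g.val).det ≠ 0 := by
    rw [det_diagPart_of_toBlocks₁₂_eq_zero hupper]
    exact Matrix.GeneralLinearGroup.det_ne_zero g
  let h : GL (m ⊕ n) K := Matrix.GeneralLinearGroup.mkOfDetNeZero _ hdet
  have hh : h ∈ G := hG.mem_of_forall_ideal fun p hp => by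
    rw [← hg _ (Or.inl (Or.inl ⟨p, hp, rfl⟩)), aeval_aeval_diagPart]
    rfl
  have hB : h⁻¹.val * (g.val - h.val) ∈ W := mem_iff_forall_trace_mul_eq_zero.2 fun Φ hΦ => by
    have hlower := hg _ (Or.inr ⟨Φ, hΦ, rfl⟩)
    have hadj : (diagPart g.val).adjugate = h.val.det • h⁻¹.val := adjugate_eq_det_smul_inv h
    rw [aeval_lowerPoly, hadj, show diagPart g.val = h.val from rfl] at hlower
    simpa [Algebra.algebraMap_self, Matrix.GeneralLinearGroup.det_ne_zero h] using hlower
  refine (mem_sup_vectorGroup_iff hW hGW).2 ⟨h, hh, _, hB, ?_⟩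
  rw [mul_add, ← mul_assoc, ← Units.val_mul, mul_inv_cancel, Units.val_one, one_mul, mul_one,
    add_sub_cancel]

theorem isAlgebraicGroup_sup_vectorGroup (hG : IsAlgebraicGroup G) (hGb : IsBlockDiagonal G)
    (hW : IsLowerLeft W) (hGW : G.toSubmonoid ≤ conjStabilizer W) :
    IsAlgebraicGroup (G ⊔ vectorGroup W hW) :=
  isClosed_zariski_iff.2 ⟨blockEquations G W, Set.ext fun _ =>
    ⟨fun hg _ hq => mem_ideal.1 (blockEquations_subset_ideal hGb hW hGW hq) _ hg,
      mem_sup_vectorGroup_of_blockEquations hG hW hGW⟩⟩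

theorem isZariskiConnected_sup_vectorGroup [Infinite K] (hG : IsZariskiConnected G)
    (hW : IsLowerLeft W) (hGW : G.toSubmonoid ≤ conjStabilizer W) :
    IsZariskiConnected (G ⊔ vectorGroup W hW) := by
  let := zariski (m ⊕ n) K
  have : ContinuousConstSMul (GL (m ⊕ n) K) (GL (m ⊕ n) K) := ⟨continuous_mul_left_zariski⟩
  refine ⟨⟨1, Subgroup.one_mem _⟩, ?_⟩
  rw [coe_sup_vectorGroup hW hGW]
  exact isPreconnected_mul_of_one_mem hG.isPreconnected (isPreconnected_vectorGroup hW)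
    G.one_mem (Subgroup.one_mem _)

theorem diagPart_mem_tangentSpace (hG : IsBlockDiagonal G) (hW : IsLowerLeft W)
    (hGW : G.toSubmonoid ≤ conjStabilizer W) {N : Matrix (m ⊕ n) (m ⊕ n) K}
    (hN : N ∈ tangentSpace (G ⊔ vectorGroup W hW)) : diagPart N ∈ tangentSpace G := by
  intro p hp
  rw [← diagPart_onePlusEps, ← aeval_aeval_diagPart]
  exact hN _ (blockEquations_subset_ideal hG hW hGW (Or.inl (Or.inl ⟨p, hp, rfl⟩)))

theorem sub_diagPart_mem (hG : IsBlockDiagonal G) (hW : IsLowerLeft W)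
    (hGW : G.toSubmonoid ≤ conjStabilizer W) {N : Matrix (m ⊕ n) (m ⊕ n) K}
    (hN : N ∈ tangentSpace (G ⊔ vectorGroup W hW)) : N - diagPart N ∈ W := by
  refine mem_iff_forall_trace_mul_eq_zero.2 fun Φ hΦ => ?_
  have hlower := hN _ (blockEquations_subset_ideal hG hW hGW (Or.inr ⟨Φ, hΦ, rfl⟩))
  have hdiff : onePlusEps N - onePlusEps (diagPart N) = (DualNumber.eps : DualNumber K) •
      (N - diagPart N).map (algebraMap K (DualNumber K)) := by
    rw [Matrix.map_sub _ (map_sub _), smul_sub, onePlusEps, onePlusEps, add_sub_add_left_eq_sub]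
  have htrace := AddMonoidHom.map_trace (algebraMap K (DualNumber K)) (Φ * (N - diagPart N))
  rw [aeval_lowerPoly, diagPart_onePlusEps, hdiff, adjugate_onePlusEps_mul_eps_smul,
    Matrix.mul_smul, Matrix.trace_smul, ← Matrix.map_mul, ← htrace] at hlower
  simpa [TrivSqZeroExt.algebraMap_eq_inl] using congrArg TrivSqZeroExt.snd hlower

theorem tangentSpace_sup_vectorGroup [Infinite K] (hG : IsBlockDiagonal G) (hW : IsLowerLeft W)
    (hGW : G.toSubmonoid ≤ conjStabilizer W) :
    tangentSpace (G ⊔ vectorGroup W hW) = tangentSpace G ⊔ W := by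
  refine le_antisymm (fun N hN => ?_) (sup_le (tangentSpace_mono le_sup_left)
    ((le_tangentSpace_vectorGroup hW).trans (tangentSpace_mono le_sup_right)))
  rw [← add_sub_cancel (diagPart N) N]
  exact Submodule.add_mem_sup (diagPart_mem_tangentSpace hG hW hGW hN)
    (sub_diagPart_mem hG hW hGW hN)

theorem IsBlockDiagonal.diagPart_eq_self (hG : IsBlockDiagonal G)
    {N : Matrix (m ⊕ n) (m ⊕ n) K} (hN : N ∈ tangentSpace G) : diagPart N = N := by
  have hentry (x : (m ⊕ n) × (m ⊕ n)) (hx : ∀ g ∈ G, g.val.entries x = 0) : N.entries x = 0 := by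
    have h := isTangent_iff.1 hN (X x) (mem_ideal.2 fun g hg => by rw [aeval_X, hx g hg])
    simpa [pderiv_X, Pi.single_apply, apply_ite] using h
  ext (i | i) (j | j)
  · rfl
  · refine (hentry (Sum.inl i, Sum.inr j) fun g hg => ?_).symm
    obtain ⟨P, S, hPS⟩ := hG g hg
    simp [Matrix.entries, hPS]
  · refine (hentry (Sum.inr i, Sum.inl j) fun g hg => ?_).symm
    obtain ⟨P, S, hPS⟩ := hG g hg
    simp [Matrix.entries, hPS]
  · rfl

theorem disjoint_tangentSpace (hG : IsBlockDiagonal G) (hW : IsLowerLeft W) :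
    Disjoint (tangentSpace G) W := by
  rw [Submodule.disjoint_def]
  intro N hN hNW
  obtain ⟨Z, rfl⟩ := hW N hNW
  rw [← hG.diagPart_eq_self hN, diagPart_fromBlocks, Matrix.fromBlocks_zero]

end SemidirectProduct

end LinAlgGroup

open LinAlgGroup in
theorem mainTheorem6_general {m n K : Type*} [Fintype m] [DecidableEq m] [Fintype n]
    [DecidableEq n] [Field K] [CharZero K] (hdiag : LieSubalgebra K (Matrix (m ⊕ n) (m ⊕ n) K))
    (hsub : Submodule K (Matrix (m ⊕ n) (m ⊕ n) K)) (hlow : IsLowerLeft hsub)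
    (hstable : ∀ (N₁ : Matrix m m K) (N₂ : Matrix n n K) (X : Matrix n m K),
      Matrix.fromBlocks N₁ 0 0 N₂ ∈ hdiag → Matrix.fromBlocks 0 0 X 0 ∈ hsub →
        Matrix.fromBlocks 0 0 (N₂ * X - X * N₁) 0 ∈ hsub)
    (Hdiag : Subgroup (GL (m ⊕ n) K)) (halg : IsAlgebraicGroup Hdiag)
    (hconn : IsZariskiConnected Hdiag) (hblock : IsBlockDiagonal Hdiag)
    (hLie : lieAlgebra Hdiag = hdiag) :
    IsAlgebraicGroup (Hdiag ⊔ vectorGroup hsub hlow) ∧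
    IsZariskiConnected (Hdiag ⊔ vectorGroup hsub hlow) ∧
    Disjoint hdiag.toSubmodule hsub ∧
    (lieAlgebra (Hdiag ⊔ vectorGroup hsub hlow)).toSubmodule = hdiag.toSubmodule ⊔ hsub ∧
    ∃ h : LieSubalgebra K (Matrix (m ⊕ n) (m ⊕ n) K),
      h.toSubmodule = hdiag.toSubmodule ⊔ hsub ∧ IsAlgebraicLie h := by
  subst hLie
  have hstab : Hdiag.toSubmonoid ≤ conjStabilizer hsub :=
    le_conjStabilizer_of_lie_mem hconn fun N hN B hB => by
      obtain ⟨X, rfl⟩ := hlow B hB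
      have hNdiag : diagPart N = N := hblock.diagPart_eq_self hN
      rw [← hNdiag, diagPart, lie_fromBlocks_diagonal_lowerLeft]
      exact hstable _ _ X (hNdiag.symm ▸ hN : diagPart N ∈ _) hB
  have hclosed := isAlgebraicGroup_sup_vectorGroup halg hblock hlow hstab
  have htangent := tangentSpace_sup_vectorGroup hblock hlow hstab
  exact ⟨hclosed, isZariskiConnected_sup_vectorGroup hconn hlow hstab,
    disjoint_tangentSpace hblock hlow, htangent, lieAlgebra _, htangent, _, hclosed, rfl⟩

theorem mainTheorem6 {C : Type*} [Field C] [IsAlgClosed C] [CharZero C] (n₁ n₂ : ℕ)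
    (hdiag : LieSubalgebra C (Matrix (Fin n₁ ⊕ Fin n₂) (Fin n₁ ⊕ Fin n₂) C))
    (hsub : Submodule C (Matrix (Fin n₁ ⊕ Fin n₂) (Fin n₁ ⊕ Fin n₂) C))
    (hlow : LinAlgGroup.IsLowerLeft hsub)
    (hstable : ∀ (N₁ : Matrix (Fin n₁) (Fin n₁) C) (N₂ : Matrix (Fin n₂) (Fin n₂) C)
      (X : Matrix (Fin n₂) (Fin n₁) C),
      Matrix.fromBlocks N₁ 0 0 N₂ ∈ hdiag → Matrix.fromBlocks 0 0 X 0 ∈ hsub →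
        Matrix.fromBlocks 0 0 (N₂ * X - X * N₁) 0 ∈ hsub)
    (Hdiag : Subgroup (GL (Fin n₁ ⊕ Fin n₂) C))
    (halg : LinAlgGroup.IsAlgebraicGroup Hdiag) (hconn : LinAlgGroup.IsZariskiConnected Hdiag)
    (hblock : LinAlgGroup.IsBlockDiagonal Hdiag) (hLie : LinAlgGroup.lieAlgebra Hdiag = hdiag) :
    LinAlgGroup.IsAlgebraicGroup (Hdiag ⊔ LinAlgGroup.vectorGroup hsub hlow) ∧
    LinAlgGroup.IsZariskiConnected (Hdiag ⊔ LinAlgGroup.vectorGroup hsub hlow) ∧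
    Disjoint hdiag.toSubmodule hsub ∧
    (LinAlgGroup.lieAlgebra (Hdiag ⊔ LinAlgGroup.vectorGroup hsub hlow)).toSubmodule = hdiag.toSubmodule ⊔ hsub ∧
    ∃ h : LieSubalgebra C (Matrix (Fin n₁ ⊕ Fin n₂) (Fin n₁ ⊕ Fin n₂) C),
      h.toSubmodule = hdiag.toSubmodule ⊔ hsub ∧ LinAlgGroup.IsAlgebraicLie h := by
  exact mainTheorem6_general hdiag hsub hlow hstable Hdiag halg hconn hblock hLie
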